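/- Let $n\ge 3$ be an odd integer and $h=\frac{n-1}{2}$. Let $\mathbb{R}_n$ be the real Clifford algebra generated by $e_1,\dots,e_n$ with $e_\ell^2=-1$ and $e_\ell e_m+e_me_\ell=0$ for $\ell\ne m$; identify $s=(s_0,\dots,s_n)\in\mathbb{R}^{n+1}$ with the paravector $s_0+\sum_{j=1}^n s_je_j\in\mathbb{R}_n$, and let $|s|$ be its Euclidean norm. Let $V$ be a real Banach space and let $V_n=V\otimes\mathbb{R}_n$ carry a complete norm for which $v\mapsto v\otimes a$ is continuous for every $a\in\mathbb{R}_n$ (for example $\|\sum_A v_Ae_A\|=\sum_A\|v_A\|$). Let $\mathcal{B}(V_n)$ be the algebra of bounded right $\mathbb{R}_n$-linear operators on $V_n$ with the operator norm; a bounded operator $S$ on $V$ and $a\in\mathbb{R}_n$ define $aS\in\mathcal{B}(V_n)$ by $(aS)(v\otimes b)=Sv\otimes ab$, and $a$ is identified with $a\mathcal{I}$. Let $T_0,\dots,T_n$ be pairwise commuting bounded linear operators on $V$, and put $T=T_0+\sum_{j=1}^n e_jT_j$, $\overline{T}=T_0-\sum_{j=1}^n e_jT_j$. Put $$\gamma_n=(-1)^{h}\,2^{n-1}(h!)^2,\qquad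 K_\ell(m,h)=4^h(-1)^h h\,\frac{(m-\ell-h+1)!\,(\ell+h-2)!}{(\ell-1)!\,(m-\ell-2h+1)!}.$$ If $s\in\mathbb{R}^{n+1}$ and $\|T\|<|s|$, then $s$ is invertible in $\mathbb{R}_n$, the operator $s^2\mathcal{I}-(T+\overline{T})s+T\overline{T}$ is invertible in $\mathcal{B}(V_n)$, and the following two series converge (unconditionally) in the norm of $\mathcal{B}(V_n)$, with the indicated sums: $$\sum_{m=2h}^{\infty}\sum_{\ell=1}^{m-2h+1}K_\ell(m,h)\,T^{m-2h-\ell+1}\,\overline{T}^{\,\ell-1}s^{-1-m}=\gamma_n\,(s\mathcal{I}-\overline{T})\,\bigl(s^2\mathcal{I}-(T+\overline{T})s+T\overline{T}\bigr)^{-(h+1)},$$ $$\sum_{m=2h}^{\infty}\sum_{\ell=1}^{m-2h+1}K_\ell(m,h)\,s^{-1-m}\,T^{m-2h-\ell+1}\,\overline{T}^{\,\ell-1}=\gamma_n\,\bigl(s^2\mathcal{I}-(T+\overline{T})s+T\overline{T}\bigr)^{-(h+1)}\,(s\mathcal{I}-\overline{T}).$$ -/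

import Mathlib

open scoped TensorProduct Nat

noncomputable section

namespace CliffordF

/-! ### The real Clifford algebra `ℝ_n` and paravectors -/

/-- The quadratic form `x ↦ -(x₁² + ⋯ + xₙ²)` on `ℝⁿ`. -/
abbrev negForm (n : ℕ) : QuadraticForm ℝ (Fin n → ℝ) :=
  QuadraticMap.weightedSumSquares ℝ (fun _ : Fin n => (-1 : ℝ))

/-- The real Clifford algebra `ℝ_n`, generated by `e₁, …, eₙ` with `e_ℓ² = -1` and
`e_ℓ e_m + e_m e_ℓ = 0` for `ℓ ≠ m`. -/
abbrev Cl (n : ℕ) : Type := CliffordAlgebra (negForm n)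

/-- The imaginary units; `e j` is the unit `e_{j+1}` of the usual numbering from `1` to `n`. -/
def e {n : ℕ} (j : Fin n) : Cl n := CliffordAlgebra.ι (negForm n) (Pi.single j 1)

/-- The point `(s₀, …, sₙ)` of `ℝ^{n+1}` seen as the paravector `s₀ + s₁e₁ + ⋯ + sₙeₙ`. The norm
of `EuclideanSpace ℝ (Fin (n + 1))` is the modulus `|s|`. -/
def paravector {n : ℕ} (s : EuclideanSpace ℝ (Fin (n + 1))) : Cl n :=
  algebraMap ℝ (Cl n) (s 0) + ∑ j : Fin n, s j.succ • e j

theorem e_mul_self {n : ℕ} (j : Fin n) : (e j : Cl n) * e j = -1 := by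
  rw [e, CliffordAlgebra.ι_sq_scalar, QuadraticMap.weightedSumSquares_apply,
    Finset.sum_eq_single j]
  · simp
  · intro i _ hi
    simp [Pi.single_eq_of_ne hi]
  · simp

theorem e_mul_add_swap {n : ℕ} {i j : Fin n} (h : i ≠ j) :
    (e i : Cl n) * e j + e j * e i = 0 := by
  rw [e, e, CliffordAlgebra.ι_mul_ι_add_swap, QuadraticMap.polar]
  simp only [QuadraticMap.weightedSumSquares_apply, ← Finset.sum_sub_distrib]
  rw [Finset.sum_eq_zero, map_zero]
  intro k _
  by_cases h1 : k = i
  · subst h1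
    simp [Pi.single_eq_of_ne h]
  · simp [Pi.single_eq_of_ne h1]

/-- `ℝ_n` is finite dimensional. -/
instance finite_Cl (n : ℕ) : Module.Finite ℝ (Cl n) := by
  have key : Module.Finite ℝ (ExteriorAlgebra ℝ (Fin n → ℝ)) := by
    have htop : (⨆ i : ℕ, ⋀[ℝ]^i (Fin n → ℝ)) = ⊤ :=
      (DirectSum.Decomposition.isInternal
        (fun i : ℕ => ⋀[ℝ]^i (Fin n → ℝ))).submodule_iSup_eq_top
    have hle : (⨆ i : ℕ, ⋀[ℝ]^i (Fin n → ℝ))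
        ≤ ⨆ i : Fin (n + 1), ⋀[ℝ]^(i : ℕ) (Fin n → ℝ) := by
      refine iSup_le fun i => ?_
      by_cases hi : i < n + 1
      · exact le_iSup (fun i : Fin (n + 1) => ⋀[ℝ]^(i : ℕ) (Fin n → ℝ)) ⟨i, hi⟩
      · have h0 : Module.finrank ℝ (⋀[ℝ]^i (Fin n → ℝ)) = 0 := by
          rw [exteriorPower.finrank_eq, Module.finrank_fin_fun]
          exact Nat.choose_eq_zero_of_lt (by omega)
        have h1 : ⋀[ℝ]^i (Fin n → ℝ) = ⊥ := Submodule.finrank_eq_zero.mp h0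
        rw [h1]
        exact bot_le
    refine ⟨?_⟩
    rw [← top_le_iff.mp (htop ▸ hle)]
    exact Submodule.fg_iSup _ fun i => (Module.Finite.iff_fg).mp inferInstance
  exact Module.Finite.equiv (CliffordAlgebra.equivExterior (negForm n)).symm

/-! ### The two-sided Clifford Banach module `V_n = V ⊗ ℝ_n` -/

section Module

variable {n : ℕ} {V W : Type*} [NormedAddCommGroup V] [NormedSpace ℝ V]
  [NormedAddCommGroup W] [NormedSpace ℝ W]

/-- A realisation of `V_n = V ⊗ ℝ_n` as the Banach space `W`: a linear identification of the
algebraic tensor product with `W` whose coordinate inclusions `v ↦ v ⊗ a` are continuous (used with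
`V` and `W` complete). Any of the usual norms on `V_n`, such as `‖∑ v_A e_A‖ = ∑ ‖v_A‖`, is of
this kind. -/
structure CliffordBanachModule (n : ℕ) (V W : Type*) [NormedAddCommGroup V] [NormedSpace ℝ V]
    [NormedAddCommGroup W] [NormedSpace ℝ W] where
  /-- The identification of `V ⊗ ℝ_n` with `W`. -/
  equiv : V ⊗[ℝ] Cl n ≃ₗ[ℝ] W
  continuous_tmul : ∀ a : Cl n, Continuous fun v : V => equiv (v ⊗ₜ[ℝ] a)

namespace CliffordBanachModule

variable (M : CliffordBanachModule n V W)

/-- Since `V` and `W` are complete, `W` has the topology of a finite direct sum of copies of `V`;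
so a linear map on `W` is continuous as soon as it is so on each `V ⊗ a`. -/
theorem continuous_of_tmul [CompleteSpace V] [CompleteSpace W] (L : W →ₗ[ℝ] W)
    (hL : ∀ a : Cl n, Continuous fun v : V => L (M.equiv (v ⊗ₜ[ℝ] a))) : Continuous L := by
  classical
  let b := Module.finBasis ℝ (Cl n)
  let coord : V ⊗[ℝ] Cl n ≃ₗ[ℝ] (Fin (Module.finrank ℝ (Cl n)) → V) :=
    (TensorProduct.equivFinsuppOfBasisRight b).trans
      (Finsupp.linearEquivFunOnFinite ℝ V _)
  have hcoord : ∀ v, coord.symm v = ∑ i, v i ⊗ₜ[ℝ] b i := by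
    intro v
    simp only [coord, LinearEquiv.trans_symm, LinearEquiv.trans_apply]
    rw [TensorProduct.equivFinsuppOfBasisRight_symm_apply, Finsupp.sum_fintype _ _ (by simp)]
    rfl
  let F : (Fin (Module.finrank ℝ (Cl n)) → V) ≃ₗ[ℝ] W := coord.symm.trans M.equiv
  have hF : ∀ v, F v = ∑ i, M.equiv (v i ⊗ₜ[ℝ] b i) := by
    intro v
    simp only [F, LinearEquiv.trans_apply, hcoord, map_sum]
  have hFc : Continuous F := by
    have : (F : (Fin (Module.finrank ℝ (Cl n)) → V) → W)
        = fun v => ∑ i, M.equiv (v i ⊗ₜ[ℝ] b i) := funext hF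
    rw [this]
    exact continuous_finsetSum _ fun i _ => (M.continuous_tmul (b i)).comp (continuous_apply i)
  let G := F.toContinuousLinearEquivOfContinuous hFc
  have hcomp : (L : W → W) = (fun v => ∑ i, L (M.equiv (v i ⊗ₜ[ℝ] b i))) ∘ G.symm := by
    funext w
    obtain ⟨v, rfl⟩ := G.surjective w
    have hv : G v = ∑ i, M.equiv (v i ⊗ₜ[ℝ] b i) := hF v
    rw [Function.comp_apply, G.symm_apply_apply, hv, map_sum]
  rw [hcomp]
  exact (continuous_finsetSum _ fun i _ => (hL (b i)).comp (continuous_apply i)).comp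
    G.symm.continuous

/-- Right multiplication of `V_n` by `a`: `(v ⊗ b) a = v ⊗ (b a)`. -/
def rightMul (a : Cl n) : W →ₗ[ℝ] W :=
  M.equiv.conj (TensorProduct.map LinearMap.id (LinearMap.mulRight ℝ a))

/-- `𝓑(V_n)`: the algebra of bounded right linear operators on `V_n`, with composition as
multiplication and the operator norm. -/
def boundedOp : Subalgebra ℝ (W →L[ℝ] W) where
  carrier := {f | ∀ (a : Cl n) (w : W), f (M.rightMul a w) = M.rightMul a (f w)}
  mul_mem' := by
    intro f g hf hg a w
    simp only [Set.mem_ofPred_eq] at hf hg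
    simp [hg, hf]
  add_mem' := by
    intro f g hf hg a w
    simp only [Set.mem_ofPred_eq] at hf hg
    simp [hf, hg]
  algebraMap_mem' := by
    intro r a w
    simp [Algebra.algebraMap_eq_smul_one]

variable [CompleteSpace V] [CompleteSpace W]

/-- The Clifford operator `a S ∈ 𝓑(V_n)`, for `a ∈ ℝ_n` and `S` a bounded operator on `V`:
`(a S)(v ⊗ b) = S v ⊗ (a b)`. -/
def op (a : Cl n) (S : V →L[ℝ] V) : M.boundedOp :=
  ⟨⟨M.equiv.conj (TensorProduct.map (S : V →ₗ[ℝ] V) (LinearMap.mulLeft ℝ a)),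
      M.continuous_of_tmul _ fun b => by
        simpa [LinearEquiv.conj_apply, Function.comp_def] using
          (M.continuous_tmul (a * b)).comp S.continuous⟩, by
    intro c w
    obtain ⟨t, rfl⟩ := M.equiv.surjective w
    simp only [rightMul, ContinuousLinearMap.coe_mk', LinearEquiv.conj_apply_apply,
      LinearEquiv.symm_apply_apply, ← LinearMap.comp_apply, ← TensorProduct.map_comp]
    congr 2
    ext v x
    simp [mul_assoc]⟩

theorem op_apply_tmul (a : Cl n) (S : V →L[ℝ] V) (v : V) (b : Cl n) :
    (M.op a S : W →L[ℝ] W) (M.equiv (v ⊗ₜ[ℝ] b)) = M.equiv (S v ⊗ₜ[ℝ] (a * b)) := by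
  simp [op, LinearEquiv.conj_apply]

/-- The operator `a 𝓘`, left multiplication of `V_n` by `a ∈ ℝ_n`. -/
def scalarOp (a : Cl n) : M.boundedOp := M.op a 1

/-- The paravector operator `T = T₀ + e₁T₁ + ⋯ + eₙTₙ` with components `T₀, …, Tₙ`. -/
def paravectorOp (T : Fin (n + 1) → V →L[ℝ] V) : M.boundedOp :=
  M.op 1 (T 0) + ∑ j : Fin n, M.op (e j) (T j.succ)

/-- The conjugate operator `T̄ = T₀ - e₁T₁ - ⋯ - eₙTₙ`. -/
def conjOp (T : Fin (n + 1) → V →L[ℝ] V) : M.boundedOp :=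
  M.op 1 (T 0) - ∑ j : Fin n, M.op (e j) (T j.succ)

/-- The operator `s²𝓘 - (T + T̄)s + T T̄`. -/
def quadraticOp (s : EuclideanSpace ℝ (Fin (n + 1))) (T : Fin (n + 1) → V →L[ℝ] V) :
    M.boundedOp :=
  M.scalarOp (paravector s ^ 2) - (M.paravectorOp T + M.conjOp T) * M.scalarOp (paravector s)
    + M.paravectorOp T * M.conjOp T

end CliffordBanachModule

end Module

/-! ### The constants -/

/-- The Sce exponent `h = (n - 1) / 2`, for odd `n`. -/
def sceExponent (n : ℕ) : ℕ := (n - 1) / 2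

/-- `γ_n = (-1)^{(n-1)/2} 2^{n-1} [((n-1)/2)!]²`, for odd `n`. -/
def γ (n : ℕ) : ℝ := (-1) ^ ((n - 1) / 2) * 2 ^ (n - 1) * (((n - 1) / 2)! : ℝ) ^ 2

/-- `K_ℓ(m,h) = 4^h (-1)^h h (m-ℓ-h+1)! (ℓ+h-2)! / ((ℓ-1)! (m-ℓ-2h+1)!)`, used for `h ≥ 1`,
`m ≥ 2h` and `1 ≤ ℓ ≤ m - 2h + 1`; no subtraction is truncated there. -/
def K (ℓ m h : ℕ) : ℝ :=
  4 ^ h * (-1) ^ h * h *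
    (((m + 1 - ℓ - h)! * (ℓ + h - 2)! : ℝ) / ((ℓ - 1)! * (m + 1 - ℓ - 2 * h)! : ℝ))

end CliffordF

end

/-! If `s` commuted with `T` and `T̄`, the sum would be `γ_n (s - T)^{-(h+1)} (s - T̄)^{-h}`,
expanded as a product of two binomial series in `T s⁻¹` and `T̄ s⁻¹`. Commutativity is recovered by
working with operators on `A = 𝓑(V_n)`: left multiplications `L_T`, `L_T̄` commute with each other
and with right multiplication `R_s`. The scalar computation is valid for them and is then evaluated
at `1`.

The return to `A` works because `T + T̄ = 2T₀` and `T T̄ = ∑ T_j²` have no imaginary units and so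
commute with `s`. The operator `D = (R_s - L_T)(R_s - L_T̄)` involves `T`, `T̄` only through these
two elements, and acts as right multiplication by `Q = s² - (T + T̄)s + T T̄` on everything
commuting with them (`isUnit_and_hasSum_twoSided`).

In a general norm on `V_n`, neither `‖T̄‖ ≤ ‖T‖` nor `‖s⁻¹‖ ≤ |s|⁻¹` is available, so only geometric
decay of powers up to a constant is used. The constants come from the grade involution, which
conjugates `T` to `T̄`, and from a copy of `ℂ` containing `s`. -/

/-! ### Binomial series for elements with geometrically decaying powers -/

section PowerSeries

/-- Summability of binomial multiples of the powers of an element whose powers decay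
geometrically. -/
theorem summable_norm_choose_mul_pow {E : Type*} [NormedRing E] {r : E} {C q : ℝ} (hq0 : 0 ≤ q)
    (hq : q < 1) (hr : ∀ k, ‖r ^ k‖ ≤ C * q ^ k) (k : ℕ) :
    Summable fun a : ℕ => ‖((a + k).choose k : E) * r ^ a‖ := by
  have hs : Summable fun a : ℕ => C * (((a + k).choose k : ℝ) * q ^ a) :=
    (summable_choose_mul_geometric_of_norm_lt_one k
      (by rwa [Real.norm_of_nonneg hq0])).mul_left C
  refine hs.of_nonneg_of_le (fun _ => norm_nonneg _) fun a => ?_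
  calc ‖((a + k).choose k : E) * r ^ a‖ = ‖(a + k).choose k • r ^ a‖ := by rw [nsmul_eq_mul]
    _ ≤ (a + k).choose k * ‖r ^ a‖ := norm_nsmul_le
    _ ≤ (a + k).choose k * (C * q ^ a) := by gcongr; exact hr a
    _ = C * (((a + k).choose k : ℝ) * q ^ a) := by ring

/-- An element whose powers decay geometrically has `1 - r` invertible. -/
theorem isUnit_one_sub_of_norm_pow_le {E : Type*} [NormedRing E] [CompleteSpace E] {r : E}
    {C q : ℝ} (hq0 : 0 ≤ q) (hq : q < 1) (hr : ∀ k, ‖r ^ k‖ ≤ C * q ^ k) : IsUnit (1 - r) := by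
  have hs : Summable (r ^ ·) := by
    simpa using (summable_norm_choose_mul_pow hq0 hq hr 0).of_norm
  exact ⟨⟨1 - r, ∑' n, r ^ n, hs.one_sub_mul_tsum_pow, hs.tsum_pow_mul_one_sub⟩, rfl⟩

/-- The binomial series for `(1 - r)^{-(k + 1)}` when the powers of `r` decay geometrically. -/
theorem hasSum_choose_mul_pow {E : Type*} [NormedRing E] [CompleteSpace E] {r : E} {C q : ℝ}
    (hq0 : 0 ≤ q) (hq : q < 1) (hr : ∀ k, ‖r ^ k‖ ≤ C * q ^ k) (k : ℕ) :
    HasSum (fun a : ℕ => ((a + k).choose k : E) * r ^ a) (Ring.inverse (1 - r) ^ (k + 1)) := by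
  have hs : Summable fun n => ‖r ^ n‖ := by
    simpa using summable_norm_choose_mul_pow hq0 hq hr 0
  have hg : HasSum (fun n => r ^ n) (Ring.inverse (1 - r)) := by
    have h1 : ∑' n, r ^ n = Ring.inverse (1 - r) := by
      rw [← Ring.inverse_mul_cancel_left (1 - r) (∑' n, r ^ n)
        (isUnit_one_sub_of_norm_pow_le hq0 hq hr), hs.of_norm.one_sub_mul_tsum_pow, mul_one]
    exact h1 ▸ hs.of_norm.hasSum
  induction k with
  | zero => simpa using hg
  | succ k ih =>
    have I1 := summable_norm_choose_mul_pow hq0 hq hr k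
    -- Cauchy product with one more geometric series; the coefficients add up by the hockey-stick
    -- identity.
    convert! hasSum_sum_range_mul_of_summable_norm' I1 ih.summable hs hs.of_norm with a
    · have : ∑ i ∈ Finset.range (a + 1), ((i + k).choose k : E) * r ^ i * r ^ (a - i) =
          ∑ i ∈ Finset.range (a + 1), ((i + k).choose k : E) * r ^ a := by
        refine Finset.sum_congr rfl fun i hi => ?_
        rw [Finset.mem_range] at hi
        rw [mul_assoc, ← pow_add, show i + (a - i) = a by lia]
      simp [this, ← Finset.sum_mul, ← Nat.cast_sum, Nat.sum_range_add_choose a k, add_assoc]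
    · rw [ih.tsum_eq, hg.tsum_eq, ← pow_succ]

/-- The product of two binomial series, as a Cauchy product. -/
theorem hasSum_antidiagonal_choose_mul_pow {E : Type*} [NormedRing E] [CompleteSpace E] {r t : E}
    {C q : ℝ} (hq0 : 0 ≤ q) (hq : q < 1) (hr : ∀ k, ‖r ^ k‖ ≤ C * q ^ k)
    (ht : ∀ k, ‖t ^ k‖ ≤ C * q ^ k) (i j : ℕ) :
    HasSum (fun N : ℕ => ∑ p ∈ Finset.HasAntidiagonal.antidiagonal N,
        ((p.1 + i).choose i : E) * r ^ p.1 * (((p.2 + j).choose j : E) * t ^ p.2))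
      (Ring.inverse (1 - r) ^ (i + 1) * Ring.inverse (1 - t) ^ (j + 1)) := by
  have hf := summable_norm_choose_mul_pow hq0 hq hr i
  have hg := summable_norm_choose_mul_pow hq0 hq ht j
  have h := (summable_norm_sum_mul_antidiagonal_of_summable_norm hf hg).of_norm.hasSum
  rwa [← tsum_mul_tsum_eq_tsum_sum_antidiagonal_of_summable_norm hf hg,
    (hasSum_choose_mul_pow hq0 hq hr i).tsum_eq, (hasSum_choose_mul_pow hq0 hq ht j).tsum_eq] at h

end PowerSeries

/-! ### Left and right multiplication operators -/

section TwoSided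

/-- Used with `S = R_s`, `S R = R_s - L_x`, `S T = R_s - L_y` and `D = S² R T`: it identifies the
product of the two series with `(R_s - L_y) D^{-(k+2)}`. The exponent `2k + 3` is `2(k + 2) - 1`. -/
theorem units_pow_mul_inv_pow {G : Type*} [Group G] {S R T : G} (hSR : Commute S R)
    (hST : Commute S T) (hRT : Commute R T) (k : ℕ) :
    (S * S * R * T) ^ (k + 2) * (S⁻¹ ^ (2 * k + 3) * (R⁻¹ ^ (k + 1 + 1) * T⁻¹ ^ (k + 1))) =
      S * T := by
  rw [((hST.mul_left hST).mul_left hRT).mul_pow, (hSR.mul_left hSR).mul_pow,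
    (Commute.refl S).mul_pow, ← pow_add, inv_pow, inv_pow, inv_pow, ← mul_inv_rev, ← mul_inv_rev,
    mul_inv_eq_iff_eq_mul]
  have h1 : Commute (S ^ (2 * k + 3)) (T ^ (k + 2) * R ^ (k + 2)) :=
    (hST.pow_pow _ _).mul_right (hSR.pow_pow _ _)
  calc S ^ (k + 2 + (k + 2)) * R ^ (k + 2) * T ^ (k + 2)
      = S * (S ^ (2 * k + 3) * (T ^ (k + 2) * R ^ (k + 2))) := by
        rw [mul_assoc, (hRT.pow_pow _ _).eq, ← mul_assoc S, ← pow_succ']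
        ring_nf
    _ = S * T * (T ^ (k + 1) * R ^ (k + 1 + 1) * S ^ (2 * k + 3)) := by
        rw [h1.eq, pow_succ' T (k + 1)]
        simp only [mul_assoc]

variable {A : Type*} [NormedRing A] [NormedAlgebra ℝ A]

theorem mul_pow_eq (x : A) (k : ℕ) :
    ContinuousLinearMap.mul ℝ A x ^ k = ContinuousLinearMap.mul ℝ A (x ^ k) := by
  induction k with
  | zero => ext; simp
  | succ k ih =>
    rw [pow_succ, ih]; ext; simp [pow_succ, mul_assoc]

theorem flip_mul_pow_eq (x : A) (k : ℕ) :
    (ContinuousLinearMap.mul ℝ A).flip x ^ k = (ContinuousLinearMap.mul ℝ A).flip (x ^ k) := by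
  induction k with
  | zero => ext; simp
  | succ k ih => rw [pow_succ, ih]; ext; simp [pow_succ', mul_assoc]

theorem commute_mul_flip_mul (x y : A) :
    Commute (ContinuousLinearMap.mul ℝ A x) ((ContinuousLinearMap.mul ℝ A).flip y) := by
  ext; simp [mul_assoc]

/-- The two multiplications commute, so the `k`-th power is `w ↦ xᵏ w uᵏ`. -/
theorem norm_mul_flip_mul_pow_le {x u : A} {b : ℝ} {k : ℕ} (hb : ‖x ^ k‖ * ‖u ^ k‖ ≤ b) :
    ‖(ContinuousLinearMap.mul ℝ A x * (ContinuousLinearMap.mul ℝ A).flip u) ^ k‖ ≤ b := by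
  rw [(commute_mul_flip_mul x u).mul_pow, mul_pow_eq, flip_mul_pow_eq]
  refine (ContinuousLinearMap.opNorm_le_bound _ (by positivity) fun w => ?_).trans hb
  simp only [mul_apply_eq_comp, ContinuousLinearMap.mul_apply', ContinuousLinearMap.flip_apply]
  calc ‖x ^ k * (w * u ^ k)‖ ≤ ‖x ^ k‖ * (‖w‖ * ‖u ^ k‖) :=
        (norm_mul_le _ _).trans (by gcongr; exact norm_mul_le _ _)
    _ = _ := by ring

variable [CompleteSpace A]

/-- If `x`, `y` commute, and `x + y` and `x y` commute with the invertible element `s`, the series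
with binomial coefficients in `x`, `y` and `s⁻¹` sums to `(s - y) Q⁻ᵏ⁻²`, where
`Q = s² - (x + y) s + x y`. -/
theorem isUnit_and_hasSum_twoSided {x y s u : A} (hsu : s * u = 1) (hus : u * s = 1)
    (hxy : Commute x y) (hadd : Commute (x + y) s) (hmul : Commute (x * y) s)
    {C q : ℝ} (hq0 : 0 ≤ q) (hq : q < 1) (hx : ∀ k, ‖x ^ k‖ * ‖u ^ k‖ ≤ C * q ^ k)
    (hy : ∀ k, ‖y ^ k‖ * ‖u ^ k‖ ≤ C * q ^ k) (k : ℕ) :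
    IsUnit (s ^ 2 - (x + y) * s + x * y) ∧
    HasSum (fun N : ℕ => ∑ p ∈ Finset.HasAntidiagonal.antidiagonal N,
        (((p.1 + (k + 1)).choose (k + 1) : ℝ) * ((p.2 + k).choose k : ℝ)) •
          (x ^ p.1 * y ^ p.2 * u ^ (N + (2 * k + 3))))
      ((s - y) * Ring.inverse (s ^ 2 - (x + y) * s + x * y) ^ (k + 2)) := by
  set Lx := ContinuousLinearMap.mul ℝ A x with hLx
  set Ly := ContinuousLinearMap.mul ℝ A y with hLy
  set Rs := (ContinuousLinearMap.mul ℝ A).flip s with hRs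
  set Ru := (ContinuousLinearMap.mul ℝ A).flip u with hRu
  have hLxy : Commute Lx Ly := by
    ext w; simp [hLx, hLy, ← mul_assoc, hxy.eq]
  have hsu' : Rs * Ru = 1 := by ext w; simp [hRs, hRu, mul_assoc, hus]
  have hus' : Ru * Rs = 1 := by ext w; simp [hRs, hRu, mul_assoc, hsu]
  have cxs : Commute Lx Rs := commute_mul_flip_mul x s
  have cys : Commute Ly Rs := commute_mul_flip_mul y s
  have cxu : Commute Lx Ru := commute_mul_flip_mul x u
  have cyu : Commute Ly Ru := commute_mul_flip_mul y u
  have csu : Commute Rs Ru := by rw [Commute, SemiconjBy, hsu', hus']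
  have hr : ∀ k, ‖(Lx * Ru) ^ k‖ ≤ C * q ^ k := fun k => norm_mul_flip_mul_pow_le (hx k)
  have ht : ∀ k, ‖(Ly * Ru) ^ k‖ ≤ C * q ^ k := fun k => norm_mul_flip_mul_pow_le (hy k)
  set r := Lx * Ru with hrdef
  set t := Ly * Ru with htdef
  have crt : Commute r t := (hLxy.mul_right cxu).mul_left (cyu.symm.mul_right (Commute.refl _))
  have crs : Commute r Rs := cxs.mul_left csu.symm
  have cts : Commute t Rs := cys.mul_left csu.symm
  have ur := isUnit_one_sub_of_norm_pow_le hq0 hq hr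
  have ut := isUnit_one_sub_of_norm_pow_le hq0 hq ht
  obtain ⟨R, hR⟩ := ur
  obtain ⟨T, hT⟩ := ut
  let S : (A →L[ℝ] A)ˣ := ⟨Rs, Ru, hsu', hus'⟩
  have cSR : Commute S R := by
    rw [← Commute.units_val_iff, hR]; exact (Commute.one_right _).sub_right crs.symm
  have cST : Commute S T := by
    rw [← Commute.units_val_iff, hT]; exact (Commute.one_right _).sub_right cts.symm
  have cRT : Commute R T := by
    rw [← Commute.units_val_iff, hR, hT]
    exact (Commute.one_right _).sub_right ((Commute.one_left _).sub_left crt)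
  have hSR : (S * R : A →L[ℝ] A) = Rs - Lx := by
    rw [hR, mul_sub, mul_one, hrdef, ← mul_assoc]
    change Rs - Rs * Lx * Ru = _
    rw [← cxs.eq, mul_assoc, hsu', mul_one]
  have hST : (S * T : A →L[ℝ] A) = Rs - Ly := by
    rw [hT, mul_sub, mul_one, htdef, ← mul_assoc]
    change Rs - Rs * Ly * Ru = _
    rw [← cys.eq, mul_assoc, hsu', mul_one]
  -- `D` equals `(R_s - L_x)(R_s - L_y)`, which is invertible because `1 - r` and `1 - t` are.
  set D := S * S * R * T with hD
  have hDapp : ∀ w, (D : A →L[ℝ] A) w = w * s ^ 2 - (x + y) * w * s + x * y * w := by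
    intro w
    have h1 : (D : A →L[ℝ] A) = (Rs - Lx) * (Rs - Ly) := by
      have h2 : D = S * R * (S * T) := by
        rw [mul_assoc S R, ← mul_assoc R S T, ← cSR.eq, hD]
        simp only [mul_assoc]
      rw [← hSR, ← hST, h2, Units.val_mul, Units.val_mul, Units.val_mul]
    rw [h1]
    simp only [mul_apply_eq_comp, sub_apply, hRs, hLx, hLy,
      ContinuousLinearMap.mul_apply', ContinuousLinearMap.flip_apply]
    noncomm_ring
  have hDinj : Function.Injective (D : A →L[ℝ] A) := fun v w hvw => by
    have := congrArg ((D⁻¹ : (A →L[ℝ] A)ˣ) : A →L[ℝ] A) hvw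
    simpa only [← mul_apply_eq_comp, Units.inv_mul, one_apply_eq_self] using this
  have hDleft : ∀ {c w : A}, Commute (x + y) c → Commute (x * y) c →
      (D : A →L[ℝ] A) (c * w) = c * (D : A →L[ℝ] A) w := by
    intro c w h1 h2
    rw [hDapp, hDapp, ← mul_assoc (x + y), h1.eq, ← mul_assoc (x * y), h2.eq]
    noncomm_ring
  have hDright : ∀ {c w : A}, Commute c s →
      (D : A →L[ℝ] A) (w * c) = (D : A →L[ℝ] A) w * c := by
    intro c w h1
    rw [hDapp, hDapp, mul_assoc w c, (h1.pow_right 2).eq, ← mul_assoc (x + y),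
      mul_assoc _ c s, h1.eq]
    noncomm_ring
  set Q := s ^ 2 - (x + y) * s + x * y with hQ
  -- The candidate for `Q⁻¹` is `D⁻¹ 1`. Any `c` commuting with `x + y`, `x y` and `s` satisfies `D
  -- (c p) = c = D (p c)`, hence commutes with `p` by injectivity of `D`.
  obtain ⟨p, hp⟩ : ∃ p, (D : A →L[ℝ] A) p = 1 :=
    ⟨((D⁻¹ : (A →L[ℝ] A)ˣ) : A →L[ℝ] A) 1, by
      rw [← mul_apply_eq_comp, Units.mul_inv, one_apply_eq_self]⟩
  have hpc : ∀ {c : A}, Commute (x + y) c → Commute (x * y) c → Commute c s → Commute c p :=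
    fun {c} h1 h2 h3 => hDinj (by rw [hDleft h1 h2, hDright h3, hp, one_mul, mul_one])
  have hab : Commute (x + y) (x * y) :=
    ((Commute.refl x).mul_right hxy).add_left (hxy.symm.mul_right (Commute.refl y))
  have hDQ : ∀ {w}, Commute (x + y) w → Commute (x * y) w → (D : A →L[ℝ] A) w = w * Q := by
    intro w h1 h2
    rw [hDapp, hQ, h1.eq, h2.eq]
    noncomm_ring
  have hpa : Commute (x + y) p := hpc (Commute.refl _) hab.symm hadd
  have hpb : Commute (x * y) p := hpc hab (Commute.refl _) hmul
  have hps : Commute s p := hpc hadd hmul (Commute.refl s)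
  have hpQ : p * Q = 1 := by rw [← hDQ hpa hpb, hp]
  have hQp : Q * p = 1 := by
    rw [← hpQ]
    exact ((hps.pow_left 2).sub_left (hpa.mul_left hps)).add_left hpb
  have hQinv : Ring.inverse Q = p := Ring.inverse_unit ⟨Q, p, hQp, hpQ⟩
  refine ⟨⟨⟨Q, p, hQp, hpQ⟩, rfl⟩, ?_⟩
  have hsy : Commute (x + y) (s - y) :=
    hadd.sub_right (hxy.add_left (Commute.refl y))
  have hsy' : Commute (x * y) (s - y) := hmul.sub_right (hxy.mul_left (Commute.refl y))
  have hDpow : ∀ j : ℕ, ((D ^ j : (A →L[ℝ] A)ˣ) : A →L[ℝ] A) ((s - y) * p ^ j) = s - y := by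
    intro j
    induction j with
    | zero => simp
    | succ j ih =>
      rw [pow_succ, Units.val_mul, mul_apply_eq_comp,
        hDQ (hsy.mul_right (hpa.pow_right _)) (hsy'.mul_right (hpb.pow_right _)), pow_succ,
        mul_assoc, mul_assoc, hpQ, mul_one, ih]
  have hval := units_pow_mul_inv_pow cSR cST cRT k
  have hsum := ((hasSum_antidiagonal_choose_mul_pow hq0 hq hr ht (k + 1) k).mul_left
    (Ru ^ (2 * k + 3))).mapL (ContinuousLinearMap.apply ℝ A (1 : A))
  -- Both sides are compared after applying the injective `D^{k+2}`, which sends each of them to `s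
  -- - y = (R_s - L_y) 1`.
  have hlim : (s - y) * Ring.inverse Q ^ (k + 2) = ContinuousLinearMap.apply ℝ A (1 : A)
      (Ru ^ (2 * k + 3) * (Ring.inverse (1 - r) ^ (k + 1 + 1) * Ring.inverse (1 - t) ^ (k + 1))) := by
    have hinj : Function.Injective ((D ^ (k + 2) : (A →L[ℝ] A)ˣ) : A →L[ℝ] A) := fun v w hvw => by
      have := congrArg (((D ^ (k + 2))⁻¹ : (A →L[ℝ] A)ˣ) : A →L[ℝ] A) hvw
      simpa only [← mul_apply_eq_comp, Units.inv_mul, one_apply_eq_self] using this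
    apply hinj
    rw [hQinv, hDpow, ← hR, ← hT, Ring.inverse_unit, Ring.inverse_unit,
      ContinuousLinearMap.apply_apply, ← mul_apply_eq_comp]
    rw [← hD] at hval
    have h1 := congrArg (fun z : (A →L[ℝ] A)ˣ => (z : A →L[ℝ] A) 1) hval
    simp only [Units.val_mul _ _, Units.val_pow_eq_pow_val, hST] at h1
    rw [Units.val_pow_eq_pow_val]
    refine Eq.trans ?_ h1.symm
    simp [hRs, hLy]
  rw [hlim]
  convert! hsum using 2 with N
  rw [ContinuousLinearMap.apply_apply, Finset.mul_sum, sum_apply]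
  refine Finset.sum_congr rfl fun p hp => ?_
  rw [Finset.HasAntidiagonal.mem_antidiagonal] at hp
  rw [← nsmul_eq_mul _ (r ^ p.1), ← nsmul_eq_mul _ (t ^ p.2), hrdef, htdef, cxu.mul_pow,
    cyu.mul_pow, mul_pow_eq, mul_pow_eq, flip_mul_pow_eq, flip_mul_pow_eq, flip_mul_pow_eq, ← hp,
    smul_mul_smul_comm, mul_smul_comm, ← Nat.cast_mul, Nat.cast_smul_eq_nsmul, smul_apply]
  congr 1
  simp only [mul_apply_eq_comp, ContinuousLinearMap.mul_apply', ContinuousLinearMap.flip_apply,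
    one_mul, mul_assoc]
  rw [← pow_add, ← pow_add]
  ring_nf

/-- The version of `isUnit_and_hasSum_twoSided` with the powers of `s⁻¹` on the left. -/
theorem hasSum_twoSided_left {x y s u : A} (hsu : s * u = 1) (hus : u * s = 1)
    (hxy : Commute x y) (hadd : Commute (x + y) s) (hmul : Commute (x * y) s)
    {C q : ℝ} (hq0 : 0 ≤ q) (hq : q < 1) (hx : ∀ k, ‖x ^ k‖ * ‖u ^ k‖ ≤ C * q ^ k)
    (hy : ∀ k, ‖y ^ k‖ * ‖u ^ k‖ ≤ C * q ^ k) (k : ℕ) :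
    HasSum (fun N : ℕ => ∑ p ∈ Finset.HasAntidiagonal.antidiagonal N,
        (((p.1 + (k + 1)).choose (k + 1) : ℝ) * ((p.2 + k).choose k : ℝ)) •
          (u ^ (N + (2 * k + 3)) * x ^ p.1 * y ^ p.2))
      (Ring.inverse (s ^ 2 - (x + y) * s + x * y) ^ (k + 2) * (s - y)) := by
  -- The opposite algebra exchanges left and right; `Q` is unchanged there because `x + y` commutes
  -- with `s` and `x` with `y`.
  have h := isUnit_and_hasSum_twoSided (x := MulOpposite.op x) (y := MulOpposite.op y)
    (s := MulOpposite.op s) (u := MulOpposite.op u)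
    (congrArg MulOpposite.op hus) (congrArg MulOpposite.op hsu) hxy.op hadd.op
    (by rw [← MulOpposite.op_mul, ← hxy.eq]; exact hmul.op) hq0 hq
    (fun j => by simpa only [← MulOpposite.op_pow, MulOpposite.norm_op] using hx j)
    (fun j => by simpa only [← MulOpposite.op_pow, MulOpposite.norm_op] using hy j) k
  have hQ : MulOpposite.op s ^ 2 - (MulOpposite.op x + MulOpposite.op y) * MulOpposite.op s +
      MulOpposite.op x * MulOpposite.op y = MulOpposite.op (s ^ 2 - (x + y) * s + x * y) := by
    rw [hadd.eq, hxy.eq]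
    rfl
  obtain ⟨v, hv⟩ := (isUnit_and_hasSum_twoSided hsu hus hxy hadd hmul hq0 hq hx hy k).1
  have hQinv : Ring.inverse (MulOpposite.op (s ^ 2 - (x + y) * s + x * y)) =
      MulOpposite.op (Ring.inverse (s ^ 2 - (x + y) * s + x * y)) := by
    rw [← hv, Ring.inverse_unit]
    exact Ring.inverse_unit (Units.opEquiv.symm (MulOpposite.op v))
  have hsum := h.2
  rw [hQ, hQinv] at hsum
  convert! hsum.unop using 2 with N
  rw [Finset.unop_sum]
  refine Finset.sum_congr rfl fun p _ => ?_
  rw [mul_assoc, (hxy.pow_pow p.1 p.2).eq]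
  rfl

end TwoSided

/-! ### Paravectors inside copies of the complex numbers -/

namespace CliffordF

theorem paravector_eq {n : ℕ} (s : EuclideanSpace ℝ (Fin (n + 1))) :
    paravector s = algebraMap ℝ (Cl n) (s 0) +
      CliffordAlgebra.ι (negForm n) (fun j => s j.succ) := by
  rw [paravector]
  congr 1
  conv_rhs => rw [← Finset.univ_sum_single (fun j : Fin n => s j.succ)]
  rw [map_sum]
  refine Finset.sum_congr rfl fun j _ => ?_
  rw [e, ← map_smul, ← Pi.single_smul, smul_eq_mul, mul_one]

theorem norm_sq_eq_add_sum {n : ℕ} (s : EuclideanSpace ℝ (Fin (n + 1))) :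
    ‖s‖ ^ 2 = s 0 ^ 2 + ∑ j : Fin n, s j.succ ^ 2 := by
  rw [EuclideanSpace.norm_sq_eq, Fin.sum_univ_succ]
  simp

/-- Every paravector lies in the image of a homomorphism from `ℂ`, at a point of the same
modulus. -/
theorem exists_algHom_complex_eq_paravector {n : ℕ} (hn : 0 < n)
    (s : EuclideanSpace ℝ (Fin (n + 1))) :
    ∃ (ψ : ℂ →ₐ[ℝ] Cl n) (z : ℂ), ψ z = paravector s ∧ ‖z‖ = ‖s‖ := by
  set v : Fin n → ℝ := fun j => s j.succ with hv
  have hnorm (z : ℂ) (h0 : z.re = s 0) (h1 : z.im ^ 2 = ∑ j : Fin n, s j.succ ^ 2) :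
      ‖z‖ = ‖s‖ := by
    rw [← sq_eq_sq₀ (norm_nonneg _) (norm_nonneg _), norm_sq_eq_add_sum, ← h1, ← h0,
      ← Complex.normSq_eq_norm_sq, Complex.normSq_apply]
    ring
  have hsum : 0 ≤ ∑ j : Fin n, s j.succ ^ 2 := Finset.sum_nonneg fun _ _ => sq_nonneg _
  -- A real `s` has no direction of its own, so any unit serves as the image of `i`; otherwise the
  -- normalised vector part, whose square is `-1`, is used.
  by_cases h : ∑ j : Fin n, s j.succ ^ 2 = 0
  · have hv0 : v = 0 := by
      ext j
      have := (Finset.sum_eq_zero_iff_of_nonneg (fun j _ => sq_nonneg (s (Fin.succ j)))).mp h j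
        (Finset.mem_univ j)
      simpa using this
    refine ⟨Complex.liftAux (e ⟨0, hn⟩) (e_mul_self _), (s 0 : ℂ), ?_, ?_⟩
    · rw [paravector_eq, ← hv, hv0]
      simp
    · exact hnorm _ (by simp) (by simp [h])
  · set c := √(∑ j : Fin n, s j.succ ^ 2) with hc
    have hc2 : c ^ 2 = ∑ j : Fin n, s j.succ ^ 2 := Real.sq_sqrt hsum
    have hc0 : c ≠ 0 := fun h0 => h (by rw [← hc2, h0]; simp)
    refine ⟨Complex.liftAux (CliffordAlgebra.ι (negForm n) (c⁻¹ • v)) ?_, ⟨s 0, c⟩, ?_, ?_⟩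
    · rw [CliffordAlgebra.ι_sq_scalar, QuadraticMap.map_smul,
        QuadraticMap.weightedSumSquares_apply]
      have : ∑ i, (-1 : ℝ) • (v i * v i) = -c ^ 2 := by
        rw [hc2, ← Finset.sum_neg_distrib]
        exact Finset.sum_congr rfl fun i _ => by simp [hv, sq]
      rw [this, smul_eq_mul, show c⁻¹ * c⁻¹ * -c ^ 2 = -1 by field_simp, map_neg, map_one]
    · rw [Complex.liftAux_apply, paravector_eq, map_smul, smul_smul, mul_inv_cancel₀ hc0, one_smul]
    · exact hnorm _ rfl hc2

/-! ### Clifford operators on `V_n` and norm bounds for their powers -/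

namespace CliffordBanachModule

variable {n : ℕ} {V W : Type*} [NormedAddCommGroup V] [NormedSpace ℝ V]
  [NormedAddCommGroup W] [NormedSpace ℝ W] (M : CliffordBanachModule n V W)

theorem linearMap_ext {L L' : W →L[ℝ] W}
    (h : ∀ (v : V) (b : Cl n), L (M.equiv (v ⊗ₜ[ℝ] b)) = L' (M.equiv (v ⊗ₜ[ℝ] b))) : L = L' := by
  ext w
  obtain ⟨t, rfl⟩ := M.equiv.surjective w
  induction t with
  | zero => simp
  | tmul v b => exact h v b
  | add t t' ht ht' => rw [map_add, map_add, map_add, ht, ht']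

theorem boundedOp_ext {f g : M.boundedOp}
    (h : ∀ (v : V) (b : Cl n), (f : W →L[ℝ] W) (M.equiv (v ⊗ₜ[ℝ] b)) =
      (g : W →L[ℝ] W) (M.equiv (v ⊗ₜ[ℝ] b))) : f = g :=
  Subtype.ext (M.linearMap_ext h)

variable [CompleteSpace V] [CompleteSpace W]

theorem op_mul_op (a b : Cl n) (S S' : V →L[ℝ] V) :
    M.op a S * M.op b S' = M.op (a * b) (S * S') :=
  M.boundedOp_ext fun v c => by simp [op_apply_tmul, mul_assoc]

theorem op_one_one : M.op 1 1 = 1 :=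
  M.boundedOp_ext fun v c => by simp [op_apply_tmul]

theorem op_add_left (a b : Cl n) (S : V →L[ℝ] V) : M.op (a + b) S = M.op a S + M.op b S :=
  M.boundedOp_ext fun v c => by simp [op_apply_tmul, add_mul, TensorProduct.tmul_add]

theorem op_neg_left (a : Cl n) (S : V →L[ℝ] V) : M.op (-a) S = -M.op a S :=
  M.boundedOp_ext fun v c => by simp [op_apply_tmul, TensorProduct.tmul_neg]

theorem op_smul_left (r : ℝ) (a : Cl n) (S : V →L[ℝ] V) : M.op (r • a) S = r • M.op a S :=
  M.boundedOp_ext fun v c => by simp [op_apply_tmul]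

theorem commute_op_one_op {S S' : V →L[ℝ] V} (h : Commute S S') (a : Cl n) :
    Commute (M.op 1 S) (M.op a S') := by
  rw [Commute, SemiconjBy, op_mul_op, op_mul_op, one_mul, mul_one, h.eq]

/-- Left multiplication of `V_n` by `ℝ_n`, as a homomorphism into `𝓑(V_n)`. -/
noncomputable def scalarOpHom : Cl n →ₐ[ℝ] M.boundedOp :=
  AlgHom.ofLinearMap
    { toFun := M.scalarOp
      map_add' := fun a b => M.op_add_left a b 1
      map_smul' := fun r a => M.op_smul_left r a 1 }
    M.op_one_one
    (fun a b => by
      change M.op (a * b) 1 = M.op a 1 * M.op b 1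
      rw [op_mul_op, mul_one])

theorem scalarOpHom_apply (a : Cl n) : M.scalarOpHom a = M.scalarOp a := rfl

theorem continuous_rightMul (a : Cl n) : Continuous (M.rightMul a) :=
  M.continuous_of_tmul _ fun b => by
    simpa [rightMul, LinearEquiv.conj_apply] using M.continuous_tmul (b * a)

/-- Right linearity is a closed condition, since right multiplications are continuous. Completeness
is what makes the power series converge. -/
instance completeSpace_boundedOp : CompleteSpace M.boundedOp := by
  have h : IsClosed (M.boundedOp : Set (W →L[ℝ] W)) := by
    have : (M.boundedOp : Set (W →L[ℝ] W)) =
        ⋂ (a : Cl n) (w : W), {f | f (M.rightMul a w) = M.rightMul a (f w)} := by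
      ext f
      simp only [Set.mem_iInter]
      rfl
    rw [this]
    refine isClosed_iInter fun a => isClosed_iInter fun w => isClosed_eq ?_ ?_
    · exact (ContinuousLinearMap.apply ℝ W (M.rightMul a w)).continuous
    · exact (M.continuous_rightMul a).comp (ContinuousLinearMap.apply ℝ W w).continuous
  exact h.completeSpace_coe

/-- The bounded map `v ⊗ a ↦ v ⊗ α(a)` of `V_n`, where `α` is the grade involution. -/
noncomputable def gradeInvolution : W →L[ℝ] W :=
  ⟨M.equiv.conj (TensorProduct.map LinearMap.id (CliffordAlgebra.involute (Q := negForm n)).toLinearMap),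
    M.continuous_of_tmul _ fun b => by
      simpa [LinearEquiv.conj_apply] using M.continuous_tmul (CliffordAlgebra.involute b)⟩

theorem gradeInvolution_apply_tmul (v : V) (b : Cl n) :
    M.gradeInvolution (M.equiv (v ⊗ₜ[ℝ] b)) =
      M.equiv (v ⊗ₜ[ℝ] (CliffordAlgebra.involute b)) := by
  simp [gradeInvolution, LinearEquiv.conj_apply]

theorem gradeInvolution_mul_self : M.gradeInvolution * M.gradeInvolution = 1 :=
  M.linearMap_ext fun v b => by simp [gradeInvolution_apply_tmul]

theorem gradeInvolution_mul_op (a : Cl n) (S : V →L[ℝ] V) :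
    M.gradeInvolution * (M.op a S : W →L[ℝ] W) =
      (M.op (CliffordAlgebra.involute a) S : W →L[ℝ] W) * M.gradeInvolution :=
  M.linearMap_ext fun v b => by simp [gradeInvolution_apply_tmul, op_apply_tmul]

/-- The grade involution fixes `1` and negates every `e_j`. -/
theorem gradeInvolution_semiconjBy (T : Fin (n + 1) → V →L[ℝ] V) :
    SemiconjBy M.gradeInvolution (M.paravectorOp T : W →L[ℝ] W) (M.conjOp T : W →L[ℝ] W) := by
  rw [SemiconjBy, paravectorOp, conjOp]
  push_cast
  rw [mul_add, sub_mul, Finset.mul_sum, Finset.sum_mul, gradeInvolution_mul_op, map_one,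
    sub_eq_add_neg, ← Finset.sum_neg_distrib]
  congr 1
  refine Finset.sum_congr rfl fun j _ => ?_
  rw [gradeInvolution_mul_op, e, CliffordAlgebra.involute_ι, op_neg_left]
  simp

/-- The powers of the conjugate of a paravector operator grow no faster than those of the
operator. -/
theorem exists_norm_conjOp_pow_le (T : Fin (n + 1) → V →L[ℝ] V) :
    ∃ C : ℝ, 0 ≤ C ∧ ∀ k, ‖M.conjOp T ^ k‖ ≤ C * ‖M.paravectorOp T ^ k‖ := by
  -- With `α` the involution, `α² = 1` gives `T̄ᵏ = α Tᵏ α`, so one constant serves all `k`.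
  refine ⟨‖M.gradeInvolution‖ * ‖M.gradeInvolution‖, by positivity, fun k => ?_⟩
  have h := (M.gradeInvolution_semiconjBy T).pow_right k
  have h1 : ((M.conjOp T ^ k : M.boundedOp) : W →L[ℝ] W) =
      M.gradeInvolution * ((M.paravectorOp T ^ k : M.boundedOp) : W →L[ℝ] W) *
        M.gradeInvolution := by
    push_cast
    rw [h.eq, mul_assoc, gradeInvolution_mul_self, mul_one]
  change ‖((M.conjOp T ^ k : M.boundedOp) : W →L[ℝ] W)‖ ≤
    _ * ‖((M.paravectorOp T ^ k : M.boundedOp) : W →L[ℝ] W)‖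
  rw [h1]
  calc _ ≤ ‖M.gradeInvolution‖ * ‖((M.paravectorOp T ^ k : M.boundedOp) : W →L[ℝ] W)‖ *
        ‖M.gradeInvolution‖ := (norm_mul_le _ _).trans (by gcongr; exact norm_mul_le _ _)
    _ = _ := by ring

/-- The inverse powers of a nonzero paravector act on `V_n` with norms of order `|s|⁻ᵏ`. -/
theorem exists_norm_scalarOp_inverse_pow_le (hn : 0 < n) {s : EuclideanSpace ℝ (Fin (n + 1))}
    (hs : 0 < ‖s‖) :
    IsUnit (paravector s) ∧ ∃ C : ℝ, 0 ≤ C ∧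
      ∀ k, ‖M.scalarOp (Ring.inverse (paravector s)) ^ k‖ ≤ C * ‖s‖⁻¹ ^ k := by
  obtain ⟨ψ, z, hz, hzs⟩ := exists_algHom_complex_eq_paravector hn s
  have hz0 : z ≠ 0 := by rw [← norm_pos_iff, hzs]; exact hs
  have hunit : IsUnit (paravector s) := hz ▸ (IsUnit.mk0 z hz0).map ψ
  have hinv : Ring.inverse (paravector s) = ψ z⁻¹ := by
    have h1 : paravector s * ψ z⁻¹ = 1 := by rw [← hz, ← map_mul, mul_inv_cancel₀ hz0, map_one]
    rw [← Ring.inverse_mul_cancel_left _ (ψ z⁻¹) hunit, h1, mul_one]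
  -- Linear maps from the finite-dimensional `ℂ` are bounded, and the modulus on `ℂ` is
  -- multiplicative, so `‖L‖` works for every power.
  let L : ℂ →L[ℝ] M.boundedOp := (M.scalarOpHom.comp ψ).toLinearMap.toContinuousLinearMap
  refine ⟨hunit, ‖L‖, L.opNorm_nonneg, fun k => ?_⟩
  have h1 : M.scalarOp (Ring.inverse (paravector s)) ^ k = L (z⁻¹ ^ k) := by
    rw [hinv, ← scalarOpHom_apply, ← map_pow, ← map_pow]
    rfl
  rw [h1, ← hzs, ← norm_inv, ← norm_pow]
  exact L.le_opNorm _

/-! ### Commutation relations for commuting components -/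

section Commuting

variable {T : Fin (n + 1) → V →L[ℝ] V}

theorem paravectorOp_add_conjOp : M.paravectorOp T + M.conjOp T = 2 • M.op 1 (T 0) := by
  rw [paravectorOp, conjOp]
  abel

theorem commute_op_one_sum (hT : ∀ i j, Commute (T i) (T j)) :
    Commute (M.op 1 (T 0)) (∑ j : Fin n, M.op (e j) (T j.succ)) :=
  Commute.sum_right _ _ _ fun j _ => M.commute_op_one_op (hT 0 j.succ) (e j)

theorem commute_paravectorOp_conjOp (hT : ∀ i j, Commute (T i) (T j)) :
    Commute (M.paravectorOp T) (M.conjOp T) := by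
  have h := M.commute_op_one_sum hT
  exact ((Commute.refl _).sub_right h).add_left (h.symm.sub_right (Commute.refl _))

theorem sum_op_mul_self (hT : ∀ i j, Commute (T i) (T j)) :
    (∑ j : Fin n, M.op (e j) (T j.succ)) * (∑ j : Fin n, M.op (e j) (T j.succ)) =
      -∑ j : Fin n, M.op 1 (T j.succ * T j.succ) := by
  have h2 : ∀ X : M.boundedOp, (2 : ℝ) • X = X + X := fun X => two_smul ℝ X
  -- Doubling allows the double sum to be added to its transpose; off-diagonal terms then cancel by
  -- anticommutation of the units.
  apply smul_right_injective _ (two_ne_zero (α := ℝ))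
  change (2 : ℝ) • _ = (2 : ℝ) • _
  rw [h2, Finset.sum_mul_sum]
  conv_lhs => enter [2]; rw [Finset.sum_comm]
  rw [← Finset.sum_add_distrib, ← Finset.sum_neg_distrib, Finset.smul_sum]
  refine Finset.sum_congr rfl fun i _ => ?_
  rw [← Finset.sum_add_distrib, Finset.sum_eq_single i]
  · rw [op_mul_op, e_mul_self, op_neg_left, h2]
  · intro j _ hj
    rw [op_mul_op, op_mul_op, (hT j.succ i.succ).eq, ← op_add_left, e_mul_add_swap hj.symm]
    exact M.boundedOp_ext fun v c => by simp [op_apply_tmul]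
  · simp

/-- A difference of two squares, the imaginary part squaring to `-∑ T_j²`. No units survive, so the
product commutes with all of `ℝ_n`. -/
theorem paravectorOp_mul_conjOp (hT : ∀ i j, Commute (T i) (T j)) :
    M.paravectorOp T * M.conjOp T =
      M.op 1 (T 0 * T 0) + ∑ j : Fin n, M.op 1 (T j.succ * T j.succ) := by
  rw [paravectorOp, conjOp, ← (M.commute_op_one_sum hT).mul_self_sub_mul_self_eq,
    sum_op_mul_self M hT, op_mul_op, one_mul, sub_neg_eq_add]

theorem commute_op_one_scalarOp (S : V →L[ℝ] V) (a : Cl n) :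
    Commute (M.op 1 S) (M.scalarOp a) :=
  M.commute_op_one_op (Commute.one_right S) a

theorem commute_add_conjOp_scalarOp (a : Cl n) :
    Commute (M.paravectorOp T + M.conjOp T) (M.scalarOp a) := by
  rw [paravectorOp_add_conjOp]
  exact (M.commute_op_one_scalarOp _ a).smul_left 2

theorem commute_mul_conjOp_scalarOp (hT : ∀ i j, Commute (T i) (T j)) (a : Cl n) :
    Commute (M.paravectorOp T * M.conjOp T) (M.scalarOp a) := by
  rw [M.paravectorOp_mul_conjOp hT]
  exact (M.commute_op_one_scalarOp _ a).add_left
    (Commute.sum_left _ _ _ fun j _ => M.commute_op_one_scalarOp _ a)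

theorem quadraticOp_eq (s : EuclideanSpace ℝ (Fin (n + 1))) :
    M.quadraticOp s T = M.scalarOp (paravector s) ^ 2 -
      (M.paravectorOp T + M.conjOp T) * M.scalarOp (paravector s) +
        M.paravectorOp T * M.conjOp T := by
  rw [quadraticOp, ← scalarOpHom_apply, map_pow, scalarOpHom_apply]

end Commuting

end CliffordBanachModule

/-! ### Constants and reindexing -/

/-- The constants `K_ℓ(m, h)` are `γ_n` times products of binomial coefficients. -/
theorem K_eq_γ_mul_choose {n k : ℕ} (hk : (n - 1) / 2 = k + 1) (hn : n - 1 = 2 * (k + 1))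
    (a b : ℕ) :
    K (b + 1) (2 * (k + 1) + (a + b)) (k + 1) =
      γ n * (((a + (k + 1)).choose (k + 1) : ℝ) * ((b + k).choose k : ℝ)) := by
  -- With `h = k + 1`, the factor `h` in `K` completes `h! (h-1)!` to `(h!)²`, and `4^h = 2^{n-1}`.
  rw [K, γ, hk, hn, ← Nat.choose_symm_add, ← Nat.choose_symm_add, Nat.cast_add_choose,
    Nat.cast_add_choose, pow_mul,
    show 2 * (k + 1) + (a + b) + 1 - (b + 1) - (k + 1) = a + (k + 1) by lia,
    show 2 * (k + 1) + (a + b) + 1 - (b + 1) - 2 * (k + 1) = a by lia,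
    show b + 1 + (k + 1) - 2 = b + k by lia, Nat.add_sub_cancel, Nat.factorial_succ k]
  have h1 : (a ! : ℝ) ≠ 0 := by positivity
  have h2 : (b ! : ℝ) ≠ 0 := by positivity
  have h3 : (k ! : ℝ) ≠ 0 := by positivity
  push_cast
  field_simp
  norm_num

/-- Reindexing of a series over `m ≥ 2h`, `1 ≤ ℓ ≤ m - 2h + 1` by antidiagonals. -/
theorem hasSum_subtype_Icc_of_antidiagonal {E : Type*} [AddCommMonoid E] [TopologicalSpace E]
    {f : ℕ → ℕ → E} {g : ℕ → ℕ × ℕ → E} {c : ℕ} {S : E}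
    (hfg : ∀ a b, f (b + 1) (c + (a + b)) = g (a + b) (a, b))
    (h : HasSum (fun N : ℕ => ∑ p ∈ Finset.HasAntidiagonal.antidiagonal N, g N p) S) :
    HasSum (fun m : {m : ℕ // c ≤ m} => ∑ ℓ ∈ Finset.Icc 1 ((m : ℕ) - c + 1), f ℓ m) S := by
  let q : ℕ ≃ {m : ℕ // c ≤ m} :=
    { toFun := fun N => ⟨c + N, Nat.le_add_right c N⟩
      invFun := fun m => m - c
      left_inv := fun N => Nat.add_sub_cancel_left c N
      right_inv := fun m => Subtype.ext (Nat.add_sub_cancel' m.2) }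
  rw [← q.hasSum_iff]
  convert! h using 2 with N
  -- With `m = c + N`, the pair records the exponents of `T` and `T̄` in the term of index `ℓ`.
  refine Finset.sum_bij' (fun ℓ _ => (N + 1 - ℓ, ℓ - 1)) (fun p _ => p.2 + 1) ?_ ?_ ?_ ?_ ?_
  · intro ℓ hℓ
    simp only [q, Equiv.coe_fn_mk, Finset.mem_Icc] at hℓ
    simp only [Finset.HasAntidiagonal.mem_antidiagonal]
    lia
  · intro p hp
    simp only [Finset.HasAntidiagonal.mem_antidiagonal] at hp
    simp only [q, Equiv.coe_fn_mk, Finset.mem_Icc]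
    lia
  · intro ℓ hℓ
    simp only [q, Equiv.coe_fn_mk, Finset.mem_Icc] at hℓ
    change ℓ - 1 + 1 = ℓ
    lia
  · intro p hp
    simp only [Finset.HasAntidiagonal.mem_antidiagonal] at hp
    ext
    · simp; lia
    · simp
  · intro ℓ hℓ
    simp only [q, Equiv.coe_fn_mk, Finset.mem_Icc] at hℓ
    have := hfg (N + 1 - ℓ) (ℓ - 1)
    rw [show N + 1 - ℓ + (ℓ - 1) = N by lia, show ℓ - 1 + 1 = ℓ by lia] at this
    exact this

end CliffordF

/-! ### The main theorem -/

theorem mainTheorem8 {n : ℕ} (hn : Odd n) (hn3 : 3 ≤ n)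
    {V W : Type*} [NormedAddCommGroup V] [NormedSpace ℝ V] [CompleteSpace V]
    [NormedAddCommGroup W] [NormedSpace ℝ W] [CompleteSpace W]
    (M : CliffordF.CliffordBanachModule n V W)
    (T : Fin (n + 1) → V →L[ℝ] V) (hT : ∀ i j, Commute (T i) (T j))
    (s : EuclideanSpace ℝ (Fin (n + 1))) (h : ℕ) (hh : h = CliffordF.sceExponent n)
    (hs : ‖M.paravectorOp T‖ < ‖s‖) :
    IsUnit (CliffordF.paravector s) ∧ IsUnit (M.quadraticOp s T) ∧
    HasSum
      (fun m : {m : ℕ // 2 * h ≤ m} =>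
        ∑ ℓ ∈ Finset.Icc 1 ((m : ℕ) - 2 * h + 1),
          CliffordF.K ℓ m h •
            (M.paravectorOp T ^ ((m : ℕ) + 1 - 2 * h - ℓ) * M.conjOp T ^ (ℓ - 1) *
              M.scalarOp (Ring.inverse (CliffordF.paravector s) ^ (1 + (m : ℕ)))))
      (CliffordF.γ n • ((M.scalarOp (CliffordF.paravector s) - M.conjOp T) *
        Ring.inverse (M.quadraticOp s T) ^ (h + 1))) ∧
    HasSum
      (fun m : {m : ℕ // 2 * h ≤ m} =>
        ∑ ℓ ∈ Finset.Icc 1 ((m : ℕ) - 2 * h + 1),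
          CliffordF.K ℓ m h •
            (M.scalarOp (Ring.inverse (CliffordF.paravector s) ^ (1 + (m : ℕ))) *
              M.paravectorOp T ^ ((m : ℕ) + 1 - 2 * h - ℓ) * M.conjOp T ^ (ℓ - 1)))
      (CliffordF.γ n • (Ring.inverse (M.quadraticOp s T) ^ (h + 1) *
        (M.scalarOp (CliffordF.paravector s) - M.conjOp T))) := by
  -- Since `n ≥ 3`, `h` is positive; `h = k + 1` makes the binomial exponents `h + 1` and `h` equal
  -- to `k + 2` and `k + 1`.
  obtain ⟨k, hk⟩ : ∃ k, (n - 1) / 2 = k + 1 := ⟨(n - 1) / 2 - 1, by lia⟩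
  have hn2 : n - 1 = 2 * (k + 1) := by obtain ⟨j, hj⟩ := hn; lia
  obtain rfl : h = k + 1 := by rw [hh, CliffordF.sceExponent, hk]
  have hs0 : 0 < ‖s‖ := (norm_nonneg _).trans_lt hs
  obtain ⟨hunit, C, hC, hCs⟩ := M.exists_norm_scalarOp_inverse_pow_le (by lia) hs0
  obtain ⟨C', hC', hCT⟩ := M.exists_norm_conjOp_pow_le T
  have hxy := M.commute_paravectorOp_conjOp hT
  have hadd := M.commute_add_conjOp_scalarOp (T := T) (CliffordF.paravector s)
  have hmul := M.commute_mul_conjOp_scalarOp hT (CliffordF.paravector s)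
  have hupow (m : ℕ) : M.scalarOp (Ring.inverse (CliffordF.paravector s) ^ m) =
      M.scalarOp (Ring.inverse (CliffordF.paravector s)) ^ m := by
    rw [← M.scalarOpHom_apply, map_pow, M.scalarOpHom_apply]
  have hsu : M.scalarOp (CliffordF.paravector s) *
      M.scalarOp (Ring.inverse (CliffordF.paravector s)) = 1 := by
    rw [← M.scalarOpHom_apply, ← M.scalarOpHom_apply, ← map_mul,
      Ring.mul_inverse_cancel _ hunit, map_one]
  have hus : M.scalarOp (Ring.inverse (CliffordF.paravector s)) *
      M.scalarOp (CliffordF.paravector s) = 1 := by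
    rw [← M.scalarOpHom_apply, ← M.scalarOpHom_apply, ← map_mul,
      Ring.inverse_mul_cancel _ hunit, map_one]
  simp only [hupow]
  rw [M.quadraticOp_eq]
  set x := M.paravectorOp T with hx_def
  set y := M.conjOp T with hy_def
  set u := M.scalarOp (Ring.inverse (CliffordF.paravector s)) with hu_def
  set σ := M.scalarOp (CliffordF.paravector s) with hσ_def
  -- Submultiplicativity covers `j > 0` with constant `1`; the case `j = 0` needs `‖1‖`.
  obtain ⟨D, hD, hxD⟩ : ∃ D : ℝ, 0 ≤ D ∧ ∀ j, ‖x ^ j‖ ≤ D * ‖x‖ ^ j := by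
    refine ⟨max ‖(1 : M.boundedOp)‖ 1, by positivity, fun j => ?_⟩
    rcases Nat.eq_zero_or_pos j with rfl | hj
    · simp
    · exact (norm_pow_le' x hj).trans (le_mul_of_one_le_left (by positivity) (le_max_right _ _))
  have hq0 : 0 ≤ ‖x‖ * ‖s‖⁻¹ := by positivity
  have hq : ‖x‖ * ‖s‖⁻¹ < 1 := by
    rw [← div_eq_mul_inv]; exact (div_lt_one hs0).mpr hs
  -- The factor `max 1 C'` gives `x` and `y` a common constant.
  have hx (j : ℕ) : ‖x ^ j‖ * ‖u ^ j‖ ≤ (max 1 C' * D * C) * (‖x‖ * ‖s‖⁻¹) ^ j := by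
    calc ‖x ^ j‖ * ‖u ^ j‖ ≤ (D * ‖x‖ ^ j) * (C * ‖s‖⁻¹ ^ j) := by
          gcongr
          · exact hxD j
          · exact hCs j
      _ ≤ max 1 C' * ((D * ‖x‖ ^ j) * (C * ‖s‖⁻¹ ^ j)) :=
          le_mul_of_one_le_left (by positivity) (le_max_left _ _)
      _ = _ := by ring
  have hy (j : ℕ) : ‖y ^ j‖ * ‖u ^ j‖ ≤ (max 1 C' * D * C) * (‖x‖ * ‖s‖⁻¹) ^ j := by
    calc ‖y ^ j‖ * ‖u ^ j‖ ≤ (max 1 C' * (D * ‖x‖ ^ j)) * (C * ‖s‖⁻¹ ^ j) := by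
          gcongr
          · exact (hCT j).trans (mul_le_mul (le_max_right _ _) (hxD j) (by positivity)
              (by positivity))
          · exact hCs j
      _ = _ := by ring
  have hleft := isUnit_and_hasSum_twoSided hsu hus hxy hadd hmul hq0 hq hx hy k
  have hright := hasSum_twoSided_left hsu hus hxy hadd hmul hq0 hq hx hy k
  refine ⟨hunit, hleft.1, ?_, ?_⟩
  · refine CliffordF.hasSum_subtype_Icc_of_antidiagonal
      (f := fun ℓ m => CliffordF.K ℓ m (k + 1) •
        (x ^ (m + 1 - 2 * (k + 1) - ℓ) * y ^ (ℓ - 1) * u ^ (1 + m)))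
      (g := fun N p => CliffordF.γ n • ((((p.1 + (k + 1)).choose (k + 1) : ℝ) *
        ((p.2 + k).choose k : ℝ)) • (x ^ p.1 * y ^ p.2 * u ^ (N + (2 * k + 3))))) ?_ ?_
    · intro a b
      rw [CliffordF.K_eq_γ_mul_choose hk hn2, mul_smul,
        show 2 * (k + 1) + (a + b) + 1 - 2 * (k + 1) - (b + 1) = a by lia, Nat.add_sub_cancel,
        show 1 + (2 * (k + 1) + (a + b)) = a + b + (2 * k + 3) by lia]
    · simpa only [Finset.smul_sum] using hleft.2.const_smul (CliffordF.γ n)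
  · refine CliffordF.hasSum_subtype_Icc_of_antidiagonal
      (f := fun ℓ m => CliffordF.K ℓ m (k + 1) •
        (u ^ (1 + m) * x ^ (m + 1 - 2 * (k + 1) - ℓ) * y ^ (ℓ - 1)))
      (g := fun N p => CliffordF.γ n • ((((p.1 + (k + 1)).choose (k + 1) : ℝ) *
        ((p.2 + k).choose k : ℝ)) • (u ^ (N + (2 * k + 3)) * x ^ p.1 * y ^ p.2))) ?_ ?_
    · intro a b
      rw [CliffordF.K_eq_γ_mul_choose hk hn2, mul_smul,
        show 2 * (k + 1) + (a + b) + 1 - 2 * (k + 1) - (b + 1) = a by lia, Nat.add_sub_cancel,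
        show 1 + (2 * (k + 1) + (a + b)) = a + b + (2 * k + 3) by lia]
    · simpa only [Finset.smul_sum] using hright.const_smul (CliffordF.γ n)
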